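/- For an $n$-by-$n$ complex matrix $A$, acting on $\mathbb{C}^n$ with the Euclidean norm, call $A$ a partial isometry if $\|Ax\|=\|x\|$ for all $x\in(\ker A)^{\perp}$. The power partial isometry index $p(A)\in\{0,1,2,\ldots\}\cup\{\infty\}$ is the supremum of the integers $j\ge 0$ for which $I,A,A^2,\ldots,A^j$ are all partial isometries, and the ascent $a(A)$ is the smallest integer $k\ge 0$ with $\ker A^k=\ker A^{k+1}$. **Theorem 3.1.** Let $j,k\ge 0$ and $n\ge 1$ be integers. There is an $n$-by-$n$ complex matrix $A$ with $p(A)=j$ and $a(A)=k$ if and only if one of the following conditions holds: (a) $j=k\le n-1$; (b) $j\le k-1$ and $j+k\le n-1$; (c) $j\le k-2$ and $j+k=n$. -/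

import Mathlib

noncomputable section

/-- The kernel of a complex square matrix, as a subspace of the Hilbert space `ℂⁿ`. -/
def matKer {n : ℕ} (A : Matrix (Fin n) (Fin n) ℂ) : Submodule ℂ (EuclideanSpace ℂ (Fin n)) :=
  LinearMap.ker (Matrix.toEuclideanLin A)

/-- `A` is a partial isometry: `‖A x‖ = ‖x‖` for all `x` in the orthogonal complement of `ker A`. -/
def IsPartialIsometry {n : ℕ} (A : Matrix (Fin n) (Fin n) ℂ) : Prop :=
  ∀ x ∈ (matKer A)ᗮ, ‖Matrix.toEuclideanLin A x‖ = ‖x‖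

/-- The power partial isometry index `p(A)`: the supremum, possibly infinite, of the `j : ℕ` such
that `I, A, A ^ 2, …, A ^ j` are all partial isometries. -/
def powerPartialIsometryIndex {n : ℕ} (A : Matrix (Fin n) (Fin n) ℂ) : ℕ∞ :=
  sSup {p : ℕ∞ | ∃ j : ℕ, p = (j : ℕ∞) ∧ ∀ i ≤ j, IsPartialIsometry (A ^ i)}

/-- The ascent `a(A)`: the smallest `k : ℕ` with `ker (A ^ k) = ker (A ^ (k + 1))`. The set is never
empty, by `exists_matKer_pow_eq` below. -/
def ascent {n : ℕ} (A : Matrix (Fin n) (Fin n) ℂ) : ℕ :=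
  sInf {k : ℕ | matKer (A ^ k) = matKer (A ^ (k + 1))}

theorem exists_matKer_pow_eq {n : ℕ} (A : Matrix (Fin n) (Fin n) ℂ) :
    {k : ℕ | matKer (A ^ k) = matKer (A ^ (k + 1))}.Nonempty := by
  have hmono : Monotone fun k : ℕ => matKer (A ^ k) := by
    refine monotone_nat_of_le_succ fun k x hx => ?_
    simp only [matKer, LinearMap.mem_ker, Matrix.toLpLin_apply, WithLp.toLp_eq_zero] at hx ⊢
    rw [pow_succ', ← Matrix.mulVec_mulVec, hx, Matrix.mulVec_zero]
  obtain ⟨k, hk⟩ := monotone_stabilizes_iff_noetherian.mpr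
    (inferInstance : IsNoetherian ℂ (EuclideanSpace ℂ (Fin n))) ⟨_, hmono⟩
  exact ⟨k, hk (k + 1) (Nat.le_succ k)⟩

end

/-! Necessity. Let `d i` be the dimension of `ker f ∩ range (f ^ i)`, that is, `dim ker (f ^ (i +
1)) - dim ker (f ^ i)`. It is nonincreasing in `i`, and positive for `i < k`. If two consecutive
powers that are partial isometries share a kernel, all later powers are partial isometries, so `j ≤
k`. The key lemma `isPartialIsometry_pow_succ_of_kerInfRange_eq` shows that `d (j - 1) = d j` would
make `f ^ (j + 1)` a partial isometry; hence if `j < k`, then `d i ≥ 2` for all `i < j`. Summing,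
`dim ker (f ^ k)` is at least `j + k` if `j < k`, and at least `k` if `j = k`. Equality with `n`
means `f ^ k = 0`, which forces `k > j + 1`.

Sufficiency. Write `e_t` for the standard basis. Shift it along two chains of lengths `j` and `m`,
and send `e_n` to `(4/5) e_j + (3/5) e_w`. All powers keep the images of the basis orthogonal, so
only their norms matter. The image of `e_n` has norm 1 until the chain from `e_j` runs out, at power
`j + 1`, where its norm drops to 3/5. The choice `w = n` gives (a) and (b), and `w = n - 1 = j + m`
gives (c). -/

open Module

/-- A linear map is a partial isometry if it is isometric on the orthogonal complement of its
kernel. -/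
def LinearMap.IsPartialIsometry {V : Type*} [NormedAddCommGroup V] [InnerProductSpace ℂ V]
    (f : V →ₗ[ℂ] V) : Prop :=
  ∀ x ∈ (LinearMap.ker f)ᗮ, ‖f x‖ = ‖x‖

/-! ### Partial isometries and the orthogonal complement of the kernel. -/

namespace LinearMap.IsPartialIsometry

variable {V : Type*} [NormedAddCommGroup V] [InnerProductSpace ℂ V] [FiniteDimensional ℂ V]
  {f : V →ₗ[ℂ] V}

theorem inner_map_map (hf : f.IsPartialIsometry) {x : V} (hx : x ∈ (LinearMap.ker f)ᗮ) (y : V) :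
    inner ℂ (f x) (f y) = inner ℂ x y := by
  obtain ⟨p, hp, q, hq, rfl⟩ := (LinearMap.ker f).exists_add_mem_mem_orthogonal y
  let g : (LinearMap.ker f)ᗮ →ₗᵢ[ℂ] V :=
    ⟨f ∘ₗ (LinearMap.ker f)ᗮ.subtype, fun z => hf z z.2⟩
  have h := g.inner_map_map ⟨x, hx⟩ ⟨q, hq⟩
  have hxp : inner ℂ x p = 0 := Submodule.inner_left_of_mem_orthogonal hp hx
  rw [map_add, LinearMap.mem_ker.mp hp, zero_add, inner_add_right, hxp, zero_add]
  exact h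

/-- Only the component of `x` orthogonal to the kernel contributes to `‖f x‖`, so by Pythagoras the
kernel component vanishes. -/
theorem mem_orthogonal_of_norm_eq (hf : f.IsPartialIsometry) {x : V} (hx : ‖f x‖ = ‖x‖) :
    x ∈ (LinearMap.ker f)ᗮ := by
  obtain ⟨p, hp, q, hq, rfl⟩ := (LinearMap.ker f).exists_add_mem_mem_orthogonal x
  rw [map_add, LinearMap.mem_ker.mp hp, zero_add, hf q hq] at hx
  have h := norm_add_sq_eq_norm_sq_add_norm_sq_of_inner_eq_zero (𝕜 := ℂ) p q
    (Submodule.inner_right_of_mem_orthogonal hp hq)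
  rw [← hx] at h
  have : p = 0 := by
    rw [← norm_eq_zero]
    exact mul_self_eq_zero.mp (by linarith)
  rwa [this, zero_add]

end LinearMap.IsPartialIsometry

/-! ### Kernels of powers and the necessary dimension bounds. -/

namespace Module.End

variable {V : Type*} [NormedAddCommGroup V] [InnerProductSpace ℂ V] {f : End ℂ V}

theorem ker_pow_le_ker_pow (f : End ℂ V) {i j : ℕ} (h : i ≤ j) :
    LinearMap.ker (f ^ i) ≤ LinearMap.ker (f ^ j) := by
  obtain ⟨d, rfl⟩ := Nat.exists_eq_add_of_le' h
  intro x hx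
  rw [LinearMap.mem_ker] at hx ⊢
  rw [pow_add, End.mul_apply, hx, map_zero]

theorem ker_pow_add_eq {k : ℕ} (h : LinearMap.ker (f ^ k) = LinearMap.ker (f ^ (k + 1))) (d : ℕ) :
    LinearMap.ker (f ^ (k + d)) = LinearMap.ker (f ^ k) := by
  induction d with
  | zero => rfl
  | succ d ih =>
    rw [← ih]
    refine le_antisymm (fun x hx => ?_) (ker_pow_le_ker_pow f (by omega))
    rw [LinearMap.mem_ker] at hx ⊢
    have : (f ^ d) x ∈ LinearMap.ker (f ^ (k + 1)) := by
      rw [LinearMap.mem_ker, ← End.mul_apply, ← pow_add, ← hx]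
      congr 2; omega
    rw [← h, LinearMap.mem_ker, ← End.mul_apply, ← pow_add] at this
    exact this

/-- If `f ^ k` and `f ^ (k + 1)` are partial isometries with the same kernel, then so are all
higher powers of `f`. -/
theorem isPartialIsometry_pow_add [FiniteDimensional ℂ V] {k : ℕ}
    (h : LinearMap.ker (f ^ k) = LinearMap.ker (f ^ (k + 1)))
    (h0 : (f ^ k).IsPartialIsometry) (h1 : (f ^ (k + 1)).IsPartialIsometry) (d : ℕ) :
    (f ^ (k + d)).IsPartialIsometry := by
  -- With a common kernel, both norms equal that of the component of `x` orthogonal to it.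
  have hiso : ∀ x, ‖(f ^ (k + 1)) x‖ = ‖(f ^ k) x‖ := by
    intro x
    obtain ⟨p, hp, q, hq, rfl⟩ := (LinearMap.ker (f ^ k)).exists_add_mem_mem_orthogonal x
    have hp' := hp
    have hq' := hq
    rw [h] at hp' hq'
    rw [map_add, map_add, LinearMap.mem_ker.mp hp, LinearMap.mem_ker.mp hp', zero_add, zero_add,
      h0 q hq, h1 q hq']
  have hall : ∀ x, ‖(f ^ (k + d)) x‖ = ‖(f ^ k) x‖ := by
    intro x
    induction d with
    | zero => rfl
    | succ d ih =>
      rw [← ih, show k + (d + 1) = (k + 1) + d by omega, pow_add, End.mul_apply, hiso,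
        ← End.mul_apply, ← pow_add]
  intro x hx
  rw [ker_pow_add_eq h] at hx
  rw [hall, h0 x hx]

/-- The part of the kernel of `f` lying in the range of `f ^ i`; its dimension is the number of
Jordan blocks of `f` at `0` of size greater than `i`. -/
def kerInfRange (f : End ℂ V) (i : ℕ) : Submodule ℂ V :=
  LinearMap.ker f ⊓ LinearMap.range (f ^ i)

theorem kerInfRange_antitone (f : End ℂ V) : Antitone (kerInfRange f) := by
  refine antitone_nat_of_succ_le fun i => inf_le_inf_left _ ?_
  rintro _ ⟨x, rfl⟩
  exact ⟨f x, by rw [← End.mul_apply, ← pow_succ]⟩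

theorem mem_kerInfRange_iff {i : ℕ} {w : V} :
    w ∈ kerInfRange f i ↔ ∃ v ∈ LinearMap.ker (f ^ (i + 1)), (f ^ i) v = w := by
  constructor
  · rintro ⟨hw, v, rfl⟩
    refine ⟨v, ?_, rfl⟩
    rw [LinearMap.mem_ker, pow_succ', End.mul_apply]
    exact hw
  · rintro ⟨v, hv, rfl⟩
    refine ⟨?_, v, rfl⟩
    rw [LinearMap.mem_ker, pow_succ', End.mul_apply] at hv
    exact hv

/-- Rank-nullity for `f ^ i` restricted to `ker (f ^ (i + 1))`. -/
theorem finrank_ker_pow_succ [FiniteDimensional ℂ V] (f : End ℂ V) (i : ℕ) :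
    finrank ℂ (LinearMap.ker (f ^ (i + 1))) =
      finrank ℂ (LinearMap.ker (f ^ i)) + finrank ℂ (kerInfRange f i) := by
  have h := ((f ^ i).domRestrict (LinearMap.ker (f ^ (i + 1)))).finrank_range_add_finrank_ker
  have hr : LinearMap.range ((f ^ i).domRestrict (LinearMap.ker (f ^ (i + 1)))) =
      kerInfRange f i := by
    ext w
    rw [mem_kerInfRange_iff]
    simp
  have hk : finrank ℂ (LinearMap.ker ((f ^ i).domRestrict (LinearMap.ker (f ^ (i + 1))))) =
      finrank ℂ (LinearMap.ker (f ^ i)) := by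
    rw [LinearMap.ker_domRestrict]
    exact (Submodule.comapSubtypeEquivOfLe (ker_pow_le_ker_pow f (Nat.le_succ i))).finrank_eq
  rw [hr, hk] at h
  omega

/-- For `x ⟂ ker (f ^ (i + 2))` it suffices that `f ^ (i + 1) x ⟂ ker f`, since `f` then preserves
its norm. Split `f x = s + t` along `ker (f ^ (i + 1))`. The part `f ^ i t` is orthogonal to `ker
f`. By the equality of subspaces, `f ^ i s = f ^ (i + 1) v` with `v ∈ ker (f ^ (i + 2))`, so it is
orthogonal to `f ^ (i + 1) x`, and therefore zero. -/
theorem isPartialIsometry_pow_succ_of_kerInfRange_eq [FiniteDimensional ℂ V] {i : ℕ}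
    (h1 : f.IsPartialIsometry) (hi : (f ^ i).IsPartialIsometry)
    (hs : (f ^ (i + 1)).IsPartialIsometry) (h : kerInfRange f i = kerInfRange f (i + 1)) :
    (f ^ (i + 2)).IsPartialIsometry := by
  have hmap : ∀ t ∈ (LinearMap.ker (f ^ (i + 1)))ᗮ, (f ^ i) t ∈ (LinearMap.ker f)ᗮ := by
    intro t ht
    refine h1.mem_orthogonal_of_norm_eq ?_
    rw [hi t (Submodule.orthogonal_le (ker_pow_le_ker_pow f (Nat.le_succ i)) ht), ← hs t ht,
      pow_succ', End.mul_apply]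
  intro x hx
  have hx' : x ∈ (LinearMap.ker (f ^ (i + 1)))ᗮ :=
    Submodule.orthogonal_le (ker_pow_le_ker_pow f (Nat.le_succ _)) hx
  obtain ⟨s, hs', t, ht, hst⟩ := (LinearMap.ker (f ^ (i + 1))).exists_add_mem_mem_orthogonal (f x)
  have hy : (f ^ (i + 1)) x = (f ^ i) s + (f ^ i) t := by
    rw [pow_succ, End.mul_apply, hst, map_add]
  have hw : (f ^ i) s ∈ kerInfRange f i := mem_kerInfRange_iff.mpr ⟨s, hs', rfl⟩
  have hwker : (f ^ i) s ∈ LinearMap.ker f := hw.1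
  rw [h, mem_kerInfRange_iff] at hw
  obtain ⟨v, hv, hvs⟩ := hw
  have hyw : inner ℂ ((f ^ (i + 1)) x) ((f ^ i) s) = 0 := by
    rw [← hvs, hs.inner_map_map hx']
    exact Submodule.inner_left_of_mem_orthogonal hv hx
  rw [hy, inner_add_left, Submodule.inner_left_of_mem_orthogonal hwker (hmap t ht), add_zero,
    inner_self_eq_zero] at hyw
  rw [hyw, zero_add] at hy
  rw [show i + 2 = (i + 1) + 1 from rfl, pow_succ', End.mul_apply, h1 _ (hy ▸ hmap t ht), hs x hx']

/-- The dimension bounds forced by the power partial isometry index `j` and the ascent `k`. -/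
theorem index_ascent_bounds [FiniteDimensional ℂ V] {j k : ℕ}
    (hj : ∀ i ≤ j, (f ^ i).IsPartialIsometry) (hj' : ¬ (f ^ (j + 1)).IsPartialIsometry)
    (hk : LinearMap.ker (f ^ k) = LinearMap.ker (f ^ (k + 1)))
    (hk' : ∀ i < k, LinearMap.ker (f ^ i) ≠ LinearMap.ker (f ^ (i + 1))) :
    (j = k ∧ k + 1 ≤ finrank ℂ V) ∨ (j + 1 ≤ k ∧ j + k + 1 ≤ finrank ℂ V) ∨
      (j + 2 ≤ k ∧ j + k = finrank ℂ V) := by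
  have hjk : j ≤ k := by
    by_contra! hlt
    refine hj' ?_
    have := isPartialIsometry_pow_add hk (hj k hlt.le) (hj (k + 1) hlt) (j + 1 - k)
    rwa [Nat.add_sub_of_le (by omega)] at this
  have hone : ∀ i < k, 1 ≤ finrank ℂ (kerInfRange f i) := by
    intro i hi
    by_contra! h0
    have := finrank_ker_pow_succ f i
    exact hk' i hi (Submodule.eq_of_le_of_finrank_le (ker_pow_le_ker_pow f (Nat.le_succ i))
      (by omega))
  have htwo : ∀ i < j, j < k → 2 ≤ finrank ℂ (kerInfRange f i) := by
    intro i hi hlt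
    obtain ⟨l, rfl⟩ := Nat.exists_eq_add_of_le' (show 1 ≤ j by omega)
    -- By monotonicity only the index `l = j - 1` matters: dimension 1 there would force equality
    -- with the next, nonzero, subspace.
    refine le_trans ?_ (Submodule.finrank_mono (kerInfRange_antitone f (show i ≤ l by omega)))
    by_contra! hl
    refine hj' (isPartialIsometry_pow_succ_of_kerInfRange_eq ?_ (hj l (by omega)) (hj _ le_rfl) ?_)
    · simpa using hj 1 (by omega)
    · have := hone (l + 1) hlt
      exact (Submodule.eq_of_le_of_finrank_le (kerInfRange_antitone f (show l ≤ l + 1 by omega))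
        (by omega)).symm
  -- Each step adds at least 1, and one more below `j` when `j < k`; `min i j` counts these extra
  -- units.
  have hbound : ∀ i ≤ k, i + (if j < k then min i j else 0) ≤ finrank ℂ (LinearMap.ker (f ^ i)) := by
    intro i
    induction i with
    | zero => intro _; simp
    | succ i ih =>
      intro hi
      have h1 := ih (by omega)
      have h2 := hone i (by omega)
      have h3 := htwo i
      rw [finrank_ker_pow_succ]
      split_ifs at h1 ⊢ with hlt
      · by_cases hij : i < j
        · have := h3 hij hlt
          omega
        · omega
      · omega
  have hb := hbound k le_rfl
  have hle := Submodule.finrank_le (LinearMap.ker (f ^ k))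
  -- Here `f ^ k = 0`, and zero powers are partial isometries, so `f ^ (j + 1)` cannot be among
  -- them.
  have hnil : finrank ℂ (LinearMap.ker (f ^ k)) = finrank ℂ V → k ≠ j ∧ k ≠ j + 1 := by
    intro heq
    have htop := Submodule.eq_top_of_finrank_eq heq
    have hz : f ^ k = 0 := LinearMap.ker_eq_top.mp htop
    have hzero : ∀ i, k ≤ i → (f ^ i).IsPartialIsometry := by
      intro i hi x hx
      have : f ^ i = 0 := by
        rw [← Nat.add_sub_of_le hi, pow_add, hz, zero_mul]
      rw [this, LinearMap.ker_zero, Submodule.top_orthogonal_eq_bot, Submodule.mem_bot] at hx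
      simp [hx]
    exact ⟨fun h => hj' (hzero _ (by omega)), fun h => hj' (hzero _ (by omega))⟩
  split_ifs at hb with hlt
  · rw [min_eq_right hjk] at hb
    by_cases heq : j + k = finrank ℂ V
    · have := hnil (by omega)
      omega
    · omega
  · by_cases heq : k = finrank ℂ V
    · have := hnil (by omega)
      omega
    · omega

end Module.End

/-! ### From matrices to operators; the index and ascent as explicit conditions. -/

theorem matKer_pow {n : ℕ} (A : Matrix (Fin n) (Fin n) ℂ) (i : ℕ) :
    matKer (A ^ i) = LinearMap.ker ((Matrix.toEuclideanLin A : End ℂ _) ^ i) := by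
  rw [matKer, Matrix.toLpLin_pow]

theorem isPartialIsometry_pow_iff {n : ℕ} (A : Matrix (Fin n) (Fin n) ℂ) (i : ℕ) :
    IsPartialIsometry (A ^ i) ↔
      LinearMap.IsPartialIsometry ((Matrix.toEuclideanLin A : End ℂ _) ^ i) := by
  rw [IsPartialIsometry, LinearMap.IsPartialIsometry, matKer, Matrix.toLpLin_pow]

theorem powerPartialIsometryIndex_eq_iff {n : ℕ} (A : Matrix (Fin n) (Fin n) ℂ) (j : ℕ) :
    powerPartialIsometryIndex A = j ↔
      (∀ i ≤ j, IsPartialIsometry (A ^ i)) ∧ ¬ IsPartialIsometry (A ^ (j + 1)) := by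
  have hlub := isLUB_sSup {p : ℕ∞ | ∃ j : ℕ, p = (j : ℕ∞) ∧ ∀ i ≤ j, IsPartialIsometry (A ^ i)}
  have h0 : IsPartialIsometry (A ^ 0) := by
    intro x _
    simp
  constructor
  · intro h
    rw [powerPartialIsometryIndex] at h
    rw [h] at hlub
    have hall : ∀ i ≤ j, IsPartialIsometry (A ^ i) := by
      intro i hi
      by_contra hA
      -- A failure at `i > 0` bounds the supremum by `i - 1`; the zeroth power never fails.
      have hi0 : i ≠ 0 := fun h => hA (h ▸ h0)
      have : (j : ℕ∞) ≤ ((i - 1 : ℕ) : ℕ∞) := by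
        refine hlub.2 ?_
        rintro _ ⟨l, rfl, hl⟩
        rw [Nat.cast_le]
        by_contra! hlt
        exact hA (hl i (by omega))
      rw [Nat.cast_le] at this
      omega
    refine ⟨hall, fun hs => ?_⟩
    have : ((j + 1 : ℕ) : ℕ∞) ≤ j := hlub.1 ⟨j + 1, rfl, fun i hi => by
      rcases Nat.le_succ_iff.mp hi with h | h
      · exact hall i h
      · exact h ▸ hs⟩
    rw [Nat.cast_le] at this
    omega
  · rintro ⟨h, h'⟩
    refine hlub.unique ⟨?_, fun b hb => hb ⟨j, rfl, h⟩⟩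
    rintro _ ⟨l, rfl, hl⟩
    rw [Nat.cast_le]
    by_contra! hlt
    exact h' (hl _ hlt)

theorem ascent_eq_iff {n : ℕ} (A : Matrix (Fin n) (Fin n) ℂ) (k : ℕ) :
    ascent A = k ↔ matKer (A ^ k) = matKer (A ^ (k + 1)) ∧
      ∀ i < k, matKer (A ^ i) ≠ matKer (A ^ (i + 1)) := by
  constructor
  · rintro rfl
    exact ⟨Nat.sInf_mem (exists_matKer_pow_eq A), fun i hi => Nat.notMem_of_lt_sInf hi⟩
  · rintro ⟨h, h'⟩
    refine le_antisymm (Nat.sInf_le h) (le_csInf (exists_matKer_pow_eq A) fun i hi => ?_)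
    by_contra! hlt
    exact h' i hlt hi

/-! ### Operators sending an orthonormal basis to orthogonal vectors. -/

section OrthogonalImages

variable {V ι : Type*} [NormedAddCommGroup V] [InnerProductSpace ℂ V] [Fintype ι]
  (b : OrthonormalBasis ι ℂ V) {T : V →ₗ[ℂ] V}

theorem OrthonormalBasis.inner_map_eq_of_pairwise
    (h : Pairwise fun s t => inner ℂ (T (b s)) (T (b t)) = 0) (s : ι) (x : V) :
    inner ℂ (T (b s)) (T x) = inner ℂ (b s) x * inner ℂ (T (b s)) (T (b s)) := by
  conv_lhs => rw [← b.sum_repr' x, map_sum, inner_sum]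
  rw [Finset.sum_eq_single s]
  · rw [map_smul, inner_smul_right]
  · intro t _ hts
    rw [map_smul, inner_smul_right, h hts.symm, mul_zero]
  · simp

theorem OrthonormalBasis.map_eq_zero_iff_of_pairwise
    (h : Pairwise fun s t => inner ℂ (T (b s)) (T (b t)) = 0) (x : V) :
    T x = 0 ↔ ∀ s, T (b s) = 0 ∨ inner ℂ (b s) x = 0 := by
  constructor
  · intro hx s
    have := b.inner_map_eq_of_pairwise h s x
    rw [hx, inner_zero_right, eq_comm, mul_eq_zero, inner_self_eq_zero] at this
    exact this.symm
  · intro hx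
    rw [← b.sum_repr' x, map_sum]
    refine Finset.sum_eq_zero fun s _ => ?_
    rcases hx s with h | h <;> simp [h]

/-- `T* T` is diagonal in `b` with entries `‖T (b s)‖ ^ 2`, and the kernel is spanned by the `b s`
that are killed. The map is a partial isometry exactly when these entries are 0 or 1. -/
theorem OrthonormalBasis.isPartialIsometry_iff_of_pairwise [FiniteDimensional ℂ V]
    (h : Pairwise fun s t => inner ℂ (T (b s)) (T (b t)) = 0) :
    T.IsPartialIsometry ↔ ∀ s, T (b s) = 0 ∨ ‖T (b s)‖ = 1 := by
  constructor
  · intro hT s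
    refine or_iff_not_imp_left.mpr fun hs => ?_
    rw [hT (b s), b.norm_eq_one]
    intro u hu
    rw [← inner_conj_symm, ((b.map_eq_zero_iff_of_pairwise h u).mp hu s).resolve_left hs, map_zero]
  · intro hs x hx
    have hxx : LinearMap.adjoint T (T x) = x := by
      refine InnerProductSpace.ext_inner_left_basis b.toBasis fun s => ?_
      rw [b.coe_toBasis, LinearMap.adjoint_inner_right, b.inner_map_eq_of_pairwise h]
      rcases hs s with h0 | h1
      · rw [h0, inner_zero_left, mul_zero]
        exact (hx _ h0).symm
      · rw [inner_self_eq_norm_sq_to_K, h1]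
        simp
    have : inner ℂ (T x) (T x) = inner ℂ x x := by
      rw [← LinearMap.adjoint_inner_right, hxx]
    rw [norm_eq_sqrt_re_inner (𝕜 := ℂ), this, ← norm_eq_sqrt_re_inner]

end OrthogonalImages

/-! ### Construction of the examples. -/

/-- The standard basis of `ℂⁿ`, numbered from `1` to `n` and extended by zero. -/
noncomputable def stdVec (n t : ℕ) : EuclideanSpace ℂ (Fin n) :=
  if h : 1 ≤ t ∧ t ≤ n then EuclideanSpace.basisFun (Fin n) ℂ ⟨t - 1, by omega⟩ else 0

theorem stdVec_zero (n : ℕ) : stdVec n 0 = 0 := by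
  simp [stdVec]

theorem stdVec_succ {n : ℕ} (s : Fin n) :
    stdVec n (s + 1) = EuclideanSpace.basisFun (Fin n) ℂ s := by
  have := s.2
  rw [stdVec, dif_pos (by omega)]
  rfl

theorem inner_stdVec (n s t : ℕ) :
    inner ℂ (stdVec n s) (stdVec n t) = if s = t ∧ 1 ≤ s ∧ s ≤ n then 1 else 0 := by
  unfold stdVec
  by_cases hs : 1 ≤ s ∧ s ≤ n
  · by_cases ht : 1 ≤ t ∧ t ≤ n
    · rw [dif_pos hs, dif_pos ht, (EuclideanSpace.basisFun (Fin n) ℂ).inner_eq_ite]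
      refine if_congr ?_ rfl rfl
      rw [Fin.mk.injEq]
      omega
    · rw [dif_neg ht, inner_zero_right, if_neg (by omega)]
  · rw [dif_neg hs, inner_zero_left, if_neg (by omega)]

theorem norm_stdVec {n t : ℕ} (h : 1 ≤ t) (h' : t ≤ n) : ‖stdVec n t‖ = 1 := by
  rw [stdVec, dif_pos ⟨h, h'⟩, OrthonormalBasis.norm_eq_one]

theorem stdVec_ne_zero {n t : ℕ} (h : 1 ≤ t) (h' : t ≤ n) : stdVec n t ≠ 0 := by
  rw [← norm_ne_zero_iff, norm_stdVec h h']
  exact one_ne_zero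

theorem inner_stdVec_of_ne {n s t : ℕ} (h : s ≠ t ∨ s = 0) :
    inner ℂ (stdVec n s) (stdVec n t) = 0 := by
  rw [inner_stdVec, if_neg (by omega)]

/-- Orthogonality of the images under every power reduces both invariants to norms and vanishing on
basis vectors. The last hypothesis asks for a vector killed by the `k`-th power but not by the one
before. -/
theorem exists_matrix_of_orthogonal {n : ℕ} (f : End ℂ (EuclideanSpace ℂ (Fin n))) (j k : ℕ)
    (h : ∀ i s t, 1 ≤ s → s ≤ n → 1 ≤ t → t ≤ n → s ≠ t →
      inner ℂ ((f ^ i) (stdVec n s)) ((f ^ i) (stdVec n t)) = 0)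
    (hj : ∀ i ≤ j, ∀ t ≤ n, (f ^ i) (stdVec n t) = 0 ∨ ‖(f ^ i) (stdVec n t)‖ = 1)
    (hj' : ∃ t ≤ n, (f ^ (j + 1)) (stdVec n t) ≠ 0 ∧ ‖(f ^ (j + 1)) (stdVec n t)‖ ≠ 1)
    (hk : ∀ t ≤ n, (f ^ (k + 1)) (stdVec n t) = 0 → (f ^ k) (stdVec n t) = 0)
    (hk' : ∀ l, k = l + 1 → ∃ t, (f ^ (l + 1)) (stdVec n t) = 0 ∧ (f ^ l) (stdVec n t) ≠ 0) :
    ∃ A : Matrix (Fin n) (Fin n) ℂ, powerPartialIsometryIndex A = (j : ℕ∞) ∧ ascent A = k := by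
  obtain ⟨A, rfl⟩ := (Matrix.toEuclideanLin (𝕜 := ℂ) (m := Fin n) (n := Fin n)).surjective f
  have hp : ∀ i, Pairwise fun s t =>
      inner ℂ (((Matrix.toEuclideanLin A : End ℂ _) ^ i) (EuclideanSpace.basisFun (Fin n) ℂ s))
        (((Matrix.toEuclideanLin A : End ℂ _) ^ i) (EuclideanSpace.basisFun (Fin n) ℂ t)) = 0 := by
    intro i s t hst
    rw [← stdVec_succ, ← stdVec_succ]
    exact h i _ _ (by omega) (by omega) (by omega) (by omega) (by omega)
  refine ⟨A, (powerPartialIsometryIndex_eq_iff A j).mpr ⟨fun i hi => ?_, fun hA => ?_⟩,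
    (ascent_eq_iff A k).mpr ⟨?_, fun i hi heq => ?_⟩⟩
  · rw [isPartialIsometry_pow_iff, OrthonormalBasis.isPartialIsometry_iff_of_pairwise _ (hp i)]
    intro s
    rw [← stdVec_succ]
    exact hj i hi _ (by omega)
  · rw [isPartialIsometry_pow_iff, OrthonormalBasis.isPartialIsometry_iff_of_pairwise _ (hp _)] at hA
    obtain ⟨t, ht, h0, h1⟩ := hj'
    rcases t with _ | t
    · rw [stdVec_zero, map_zero] at h0
      exact h0 rfl
    · have := hA ⟨t, ht⟩
      rw [← stdVec_succ] at this
      exact this.elim h0 h1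
  · rw [matKer_pow, matKer_pow]
    refine le_antisymm (End.ker_pow_le_ker_pow _ (Nat.le_succ k)) fun x hx => ?_
    rw [LinearMap.mem_ker, OrthonormalBasis.map_eq_zero_iff_of_pairwise _ (hp _)] at hx ⊢
    intro s
    refine (hx s).imp_left fun hs => ?_
    rw [← stdVec_succ] at hs ⊢
    exact hk _ (by omega) hs
  · rw [matKer_pow, matKer_pow] at heq
    -- Stabilization at `i < k` would identify the kernels of the powers `k - 1` and `k`,
    -- contradicting the witness.
    obtain ⟨l, rfl⟩ := Nat.exists_eq_add_of_lt hi
    obtain ⟨t, ht, ht'⟩ := hk' (i + l) rfl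
    refine ht' ?_
    rw [← LinearMap.mem_ker] at ht ⊢
    rw [End.ker_pow_add_eq heq]
    rwa [add_assoc, End.ker_pow_add_eq heq] at ht

/-- The shift along the chains `j → ⋯ → 1 → 0` and `j + m → ⋯ → j + 1 → 0`, fixing everything
above `j + m`. -/
def chainShift (j m t : ℕ) : ℕ :=
  if t ≤ j + m then (if t = j + 1 then 0 else t - 1) else t

theorem iterate_chainShift (j m i t : ℕ) :
    (chainShift j m)^[i] t =
      if t ≤ j then t - i else if t ≤ j + m then (if t ≤ j + i then 0 else t - i) else t := by
  induction i with
  | zero => simp; omega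
  | succ i ih =>
    rw [Function.iterate_succ_apply', ih, chainShift]
    split_ifs <;> omega

theorem chainShift_le (j m t : ℕ) : chainShift j m t ≤ t := by
  unfold chainShift
  split_ifs <;> omega

theorem norm_smul_add_smul_eq_one {V : Type*} [NormedAddCommGroup V] [InnerProductSpace ℂ V]
    {x y : V} (hx : ‖x‖ = 1) (hy : ‖y‖ = 1) (h : inner ℂ x y = 0) :
    ‖(4 / 5 : ℂ) • x + (3 / 5 : ℂ) • y‖ = 1 := by
  have := norm_add_sq_eq_norm_sq_add_norm_sq_of_inner_eq_zero (𝕜 := ℂ)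
    ((4 / 5 : ℂ) • x) ((3 / 5 : ℂ) • y) (by rw [inner_smul_left, inner_smul_right, h]; simp)
  rw [norm_smul, norm_smul, hx, hy] at this
  norm_num at this
  rw [← sq_eq_sq₀ (norm_nonneg _) zero_le_one, sq, this]
  norm_num

/-- The operator shifting the basis vectors below `n` by `chainShift j m` and sending the last one
to a combination of the `j`-th and `w`-th. -/
noncomputable def chainOperator (n j m w : ℕ) : End ℂ (EuclideanSpace ℂ (Fin n)) :=
  (EuclideanSpace.basisFun (Fin n) ℂ).toBasis.constr ℂ fun s =>
    if (s : ℕ) + 1 < n then stdVec n (chainShift j m (s + 1))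
    else (4 / 5 : ℂ) • stdVec n j + (3 / 5 : ℂ) • stdVec n w

section ChainOperator

variable {n j m w : ℕ}

theorem chainOperator_stdVec_of_lt {t : ℕ} (ht : t < n) :
    chainOperator n j m w (stdVec n t) = stdVec n (chainShift j m t) := by
  rcases t with _ | t
  · rw [Nat.le_zero.mp (chainShift_le j m 0), stdVec_zero, map_zero]
  · have := stdVec_succ (⟨t, by omega⟩ : Fin n)
    simp only at this
    rw [this, chainOperator, ← OrthonormalBasis.coe_toBasis, Basis.constr_basis, if_pos ht]

theorem chainOperator_stdVec_last (hn : 1 ≤ n) :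
    chainOperator n j m w (stdVec n n) = (4 / 5 : ℂ) • stdVec n j + (3 / 5 : ℂ) • stdVec n w := by
  obtain ⟨l, rfl⟩ := Nat.exists_eq_add_of_le' hn
  have := stdVec_succ (Fin.last l)
  rw [Fin.val_last] at this
  rw [this, chainOperator, ← OrthonormalBasis.coe_toBasis, Basis.constr_basis, if_neg (by simp)]

theorem chainOperator_pow_stdVec_of_lt (i : ℕ) {t : ℕ} (ht : t < n) :
    (chainOperator n j m w ^ i) (stdVec n t) = stdVec n ((chainShift j m)^[i] t) := by
  induction i generalizing t with
  | zero => simp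
  | succ i ih =>
    rw [pow_succ, End.mul_apply, chainOperator_stdVec_of_lt ht,
      ih ((chainShift_le j m t).trans_lt ht), Function.iterate_succ_apply]

theorem chainOperator_pow_succ_stdVec_last (hj : j < n) (i : ℕ) :
    (chainOperator n j m w ^ (i + 1)) (stdVec n n) =
      (4 / 5 : ℂ) • stdVec n ((chainShift j m)^[i] j) +
        (3 / 5 : ℂ) • (chainOperator n j m w ^ i) (stdVec n w) := by
  rw [pow_succ, End.mul_apply, chainOperator_stdVec_last (by omega), map_add, map_smul, map_smul,
    chainOperator_pow_stdVec_of_lt i hj]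

/-- Common part of both choices of `w`. The hypothesis `horth` keeps the images of `e_n` orthogonal
to the others; `hw` and `hnorm` give them norm 1 up to power `j`, by Pythagoras with 3-4-5. -/
theorem exists_matrix_of_chainOperator {k : ℕ} (hjm : j + m < n)
    (horth : ∀ i t, t < n → inner ℂ (stdVec n ((chainShift j m)^[i + 1] t))
      ((chainOperator n j m w ^ i) (stdVec n w)) = 0)
    (hw : ∀ i, inner ℂ (stdVec n ((chainShift j m)^[i] j))
      ((chainOperator n j m w ^ i) (stdVec n w)) = 0)
    (hnorm : ∀ i ≤ j, ‖(chainOperator n j m w ^ i) (stdVec n w)‖ = 1)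
    (hk : ∀ t ≤ n, (chainOperator n j m w ^ (k + 1)) (stdVec n t) = 0 →
      (chainOperator n j m w ^ k) (stdVec n t) = 0)
    (hk' : ∀ l, k = l + 1 → ∃ t, (chainOperator n j m w ^ (l + 1)) (stdVec n t) = 0 ∧
      (chainOperator n j m w ^ l) (stdVec n t) ≠ 0) :
    ∃ A : Matrix (Fin n) (Fin n) ℂ, powerPartialIsometryIndex A = (j : ℕ∞) ∧ ascent A = k := by
  have hlast : ∀ i t, 1 ≤ t → t < n → inner ℂ ((chainOperator n j m w ^ i) (stdVec n t))
      ((chainOperator n j m w ^ i) (stdVec n n)) = 0 := by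
    intro i t h1 ht
    rw [chainOperator_pow_stdVec_of_lt i ht]
    rcases i with _ | i
    · exact inner_stdVec_of_ne (Or.inl ht.ne)
    · rw [chainOperator_pow_succ_stdVec_last (by omega), inner_add_right, inner_smul_right,
        inner_smul_right, horth i t ht, inner_stdVec_of_ne, mul_zero, mul_zero, add_zero]
      rw [iterate_chainShift, iterate_chainShift]
      split_ifs <;> omega
  refine exists_matrix_of_orthogonal (chainOperator n j m w) j k ?_ ?_ ⟨n, le_rfl, ?_⟩ hk hk'
  · intro i s t hs hs' ht ht' hst
    rcases hs'.lt_or_eq with hsn | rfl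
    · rcases ht'.lt_or_eq with htn | rfl
      · rw [chainOperator_pow_stdVec_of_lt i hsn, chainOperator_pow_stdVec_of_lt i htn]
        refine inner_stdVec_of_ne ?_
        rw [iterate_chainShift, iterate_chainShift]
        split_ifs <;> omega
      · exact hlast i s hs hsn
    · rw [← inner_conj_symm, hlast i t ht (by omega), map_zero]
  · intro i hi t ht
    rcases ht.lt_or_eq with htn | rfl
    · rw [chainOperator_pow_stdVec_of_lt i htn]
      rcases Nat.eq_zero_or_pos ((chainShift j m)^[i] t) with h | h
      · exact Or.inl (by rw [h, stdVec_zero])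
      · refine Or.inr (norm_stdVec h ?_)
        rw [iterate_chainShift]
        split_ifs <;> omega
    · right
      rcases i with _ | i
      · exact norm_stdVec (by omega) le_rfl
      · rw [chainOperator_pow_succ_stdVec_last (by omega)]
        refine norm_smul_add_smul_eq_one (norm_stdVec ?_ ?_) (hnorm i (by omega)) (hw i)
        all_goals rw [iterate_chainShift, if_pos le_rfl]; omega
  · have : ‖(chainOperator n j m w ^ (j + 1)) (stdVec n n)‖ = 3 / 5 := by
      rw [chainOperator_pow_succ_stdVec_last (by omega), iterate_chainShift, if_pos le_rfl,
        Nat.sub_self, stdVec_zero, smul_zero, zero_add, norm_smul, hnorm j le_rfl]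
      norm_num
    rw [← norm_ne_zero_iff, this]
    norm_num

/-- With `w = n` the vector `e_n` recurs in its own image and is never killed, so the ascent is the
length of the longer chain. -/
theorem exists_matrix_of_add_lt {k : ℕ} (hjm : j + m < n) (h : (m = 0 ∧ k = j) ∨ (j < m ∧ k = m)) :
    ∃ A : Matrix (Fin n) (Fin n) ℂ, powerPartialIsometryIndex A = (j : ℕ∞) ∧ ascent A = k := by
  have horth : ∀ i t, t < n → inner ℂ (stdVec n ((chainShift j m)^[i] t))
      ((chainOperator n j m n ^ i) (stdVec n n)) = 0 := by
    intro i
    induction i with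
    | zero => exact fun t ht => inner_stdVec_of_ne (Or.inl ht.ne)
    | succ i ih =>
      intro t ht
      rw [chainOperator_pow_succ_stdVec_last (by omega), inner_add_right, inner_smul_right,
        inner_smul_right, inner_stdVec_of_ne, Function.iterate_succ_apply,
        ih _ ((chainShift_le j m t).trans_lt ht), mul_zero, mul_zero, add_zero]
      rw [iterate_chainShift, iterate_chainShift]
      split_ifs <;> omega
  have hne : ∀ i, (chainOperator n j m n ^ i) (stdVec n n) ≠ 0 := by
    intro i
    induction i with
    | zero => exact stdVec_ne_zero (by omega) le_rfl
    | succ i ih =>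
      intro h0
      -- Pairing with the previous image leaves 3/5 of its squared norm.
      have := congrArg (inner ℂ ((chainOperator n j m n ^ i) (stdVec n n))) h0
      rw [chainOperator_pow_succ_stdVec_last (by omega), inner_add_right, inner_smul_right,
        inner_smul_right, ← inner_conj_symm, horth i j (by omega), inner_zero_right] at this
      simp at this
      exact ih this
  refine exists_matrix_of_chainOperator (w := n) hjm ?_ (fun i => horth i j (by omega)) ?_ ?_ ?_
  · intro i t ht
    rw [Function.iterate_succ_apply]
    exact horth i _ ((chainShift_le j m t).trans_lt ht)
  · intro i
    induction i with
    | zero => exact fun _ => norm_stdVec (by omega) le_rfl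
    | succ i ih =>
      intro hi
      rw [chainOperator_pow_succ_stdVec_last (by omega)]
      refine norm_smul_add_smul_eq_one (norm_stdVec ?_ ?_) (ih (by omega)) (horth i j (by omega))
      all_goals rw [iterate_chainShift, if_pos le_rfl]; omega
  · intro t ht h0
    rcases ht.lt_or_eq with htn | rfl
    · rw [chainOperator_pow_stdVec_of_lt _ htn] at h0 ⊢
      have hz : (chainShift j m)^[k + 1] t = 0 := by
        by_contra hz
        refine stdVec_ne_zero (Nat.one_le_iff_ne_zero.mpr hz) ?_ h0
        rw [iterate_chainShift]
        split_ifs <;> omega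
      have : (chainShift j m)^[k] t = 0 := by
        rw [iterate_chainShift] at hz ⊢
        split_ifs at hz ⊢ <;> omega
      rw [this, stdVec_zero]
    · exact absurd h0 (hne _)
  · intro l hl
    -- Top of the longer chain: `e_j` if `m = 0`, and the second chain's top if `j < m`.
    refine ⟨j + m, ?_, ?_⟩
    · rw [chainOperator_pow_stdVec_of_lt _ hjm]
      have : (chainShift j m)^[l + 1] (j + m) = 0 := by
        rw [iterate_chainShift]
        split_ifs <;> omega
      rw [this, stdVec_zero]
    · rw [chainOperator_pow_stdVec_of_lt _ hjm]
      refine stdVec_ne_zero ?_ ?_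
      all_goals
        rw [iterate_chainShift]
        split_ifs <;> omega

/-- With `w = j + m = n - 1`, `e_n` sits on top of the second chain; the operator is nilpotent and
the ascent grows to `m + 1`. -/
theorem exists_matrix_of_add_eq (hjm : j < m) (hn : j + m + 1 = n) :
    ∃ A : Matrix (Fin n) (Fin n) ℂ,
      powerPartialIsometryIndex A = (j : ℕ∞) ∧ ascent A = m + 1 := by
  have hlt : j + m < n := by omega
  refine exists_matrix_of_chainOperator (w := j + m) hlt ?_ ?_ ?_ ?_ ?_
  · intro i t ht
    rw [chainOperator_pow_stdVec_of_lt i hlt]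
    refine inner_stdVec_of_ne ?_
    rw [iterate_chainShift, iterate_chainShift]
    split_ifs <;> omega
  · intro i
    rw [chainOperator_pow_stdVec_of_lt i hlt]
    refine inner_stdVec_of_ne ?_
    rw [iterate_chainShift, iterate_chainShift]
    split_ifs <;> omega
  · intro i hi
    rw [chainOperator_pow_stdVec_of_lt i hlt]
    refine norm_stdVec ?_ ?_
    all_goals
      rw [iterate_chainShift]
      split_ifs <;> omega
  · intro t ht _
    rcases ht.lt_or_eq with htn | rfl
    · have : (chainShift j m)^[m + 1] t = 0 := by
        rw [iterate_chainShift]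
        split_ifs <;> omega
      rw [chainOperator_pow_stdVec_of_lt _ htn, this, stdVec_zero]
    · have h1 : (chainShift j m)^[m] j = 0 := by
        rw [iterate_chainShift]
        split_ifs <;> omega
      have h2 : (chainShift j m)^[m] (j + m) = 0 := by
        rw [iterate_chainShift]
        split_ifs <;> omega
      rw [chainOperator_pow_succ_stdVec_last (by omega), chainOperator_pow_stdVec_of_lt _ hlt, h1,
        h2, stdVec_zero, smul_zero, smul_zero, add_zero]
  · intro l hl
    obtain ⟨l, rfl⟩ := Nat.exists_eq_add_of_le' (show 1 ≤ l by omega)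
    have h0 : (chainShift j m)^[l + 1] j = 0 := by
      rw [iterate_chainShift]
      split_ifs <;> omega
    have h1 : (chainShift j m)^[l] j = 0 := by
      rw [iterate_chainShift]
      split_ifs <;> omega
    have h2 : (chainShift j m)^[l + 1] (j + m) = 0 := by
      rw [iterate_chainShift]
      split_ifs <;> omega
    -- Now `m = l + 1`, and `j < m` makes the `e_j` term vanish at power `m`, leaving `(3/5)
    -- e_{j+1}`, which is nonzero.
    refine ⟨n, ?_, ?_⟩
    · rw [chainOperator_pow_succ_stdVec_last (by omega), chainOperator_pow_stdVec_of_lt _ hlt, h0,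
        h2, stdVec_zero, smul_zero, smul_zero, add_zero]
    · rw [chainOperator_pow_succ_stdVec_last (by omega), chainOperator_pow_stdVec_of_lt _ hlt, h1,
        stdVec_zero, smul_zero, zero_add]
      refine smul_ne_zero (by norm_num) (stdVec_ne_zero ?_ ?_)
      all_goals
        rw [iterate_chainShift]
        split_ifs <;> omega

end ChainOperator

theorem theorem3p1 (j k n : ℕ) (hn : 1 ≤ n) :
    (∃ A : Matrix (Fin n) (Fin n) ℂ,
        powerPartialIsometryIndex A = (j : ℕ∞) ∧ ascent A = k) ↔
      (j = k ∧ k + 1 ≤ n) ∨ (j + 1 ≤ k ∧ j + k + 1 ≤ n) ∨ (j + 2 ≤ k ∧ j + k = n) := by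
  constructor
  · rintro ⟨A, hp, ha⟩
    rw [powerPartialIsometryIndex_eq_iff] at hp
    rw [ascent_eq_iff] at ha
    simp only [isPartialIsometry_pow_iff] at hp
    simp only [matKer_pow] at ha
    have hfin : finrank ℂ (EuclideanSpace ℂ (Fin n)) = n := by simp
    have := End.index_ascent_bounds hp.1 hp.2 ha.1 ha.2
    rwa [hfin] at this
  · rintro (⟨rfl, h⟩ | ⟨h1, h2⟩ | ⟨h1, h2⟩)
    · exact exists_matrix_of_add_lt (m := 0) h (Or.inl ⟨rfl, rfl⟩)
    · exact exists_matrix_of_add_lt (m := k) h2 (Or.inr ⟨h1, rfl⟩)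
    · obtain ⟨m, rfl⟩ := Nat.exists_eq_add_of_le' (show 1 ≤ k by omega)
      exact exists_matrix_of_add_eq (by omega) h2
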